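/- Let $n \ge 2$ be an integer. For a finite field $\mathbb{F}_q$ of $q$ elements, let $\mathcal{M}_n(\mathbb{F}_q)$ be the set of all $n\times n$ matrices over $\mathbb{F}_q$ and $\mathrm{GL}_n(\mathbb{F}_q)$ the group of invertible ones. For sets $\mathcal{A},\mathcal{B},\mathcal{C},\mathcal{D}\subseteq \mathcal{M}_n(\mathbb{F}_q)$ and $H\in \mathrm{GL}_n(\mathbb{F}_q)$, let $R(\mathcal{A},\mathcal{B},\mathcal{C},\mathcal{D};H)$ be the number of quadruples $(A,B,C,D)\in\mathcal{A}\times\mathcal{B}\times\mathcal{C}\times\mathcal{D}$ with $H=(A+B)(C+D)$. Then: (i) There is a constant $K(n)>0$, depending only on $n$, such that for every finite field $\mathbb{F}_q$, all sets $\mathcal{A},\mathcal{B},\mathcal{C},\mathcal{D}\subseteq \mathcal{M}_n(\mathbb{F}_q)$ and every $H\in \mathrm{GL}_n(\mathbb{F}_q)$, $$\left| R(\mathcal{A},\mathcal{B},\mathcal{C},\mathcal{D};H) - \frac{\#\mathcal{A}\,\#\mathcal{B}\,\#\mathcal{C}\,\#\mathcal{D}}{q^{n^2}} \right| \le K(n)\,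 q^{n^2-1/2}\sqrt{\#\mathcal{A}\,\#\mathcal{B}\,\#\mathcal{C}\,\#\mathcal{D}}.$$ (ii) There is a constant $c(n)>0$, depending only on $n$, such that for every finite field $\mathbb{F}_q$ and all sets $\mathcal{A},\mathcal{B},\mathcal{C},\mathcal{D}\subseteq \mathcal{M}_n(\mathbb{F}_q)$ with $\#\mathcal{A}\,\#\mathcal{B}\,\#\mathcal{C}\,\#\mathcal{D}\ge c(n)\,q^{4n^2-1}$, every $H\in\mathrm{GL}_n(\mathbb{F}_q)$ can be written as $H=(A+B)(C+D)$ with $A\in\mathcal{A}$, $B\in\mathcal{B}$, $C\in\mathcal{C}$, $D\in\mathcal{D}$. -/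

import Mathlib

/-- The number `R(A, B, C, D; H)` of solutions of the matrix equation `H = (a + b)(c + d)`
with `a ∈ A`, `b ∈ B`, `c ∈ C`, `d ∈ D`, where `A, B, C, D` are sets of `n × n` matrices
over `F`: the number of quadruples `(a, b, c, d)` in `A × B × C × D` with that property. -/
def sumProdCount {n : ℕ} {F : Type*} [Field F] [DecidableEq F]
    (A B C D : Finset (Matrix (Fin n) (Fin n) F)) (H : Matrix (Fin n) (Fin n) F) : ℕ :=
  ((A ×ˢ B ×ˢ C ×ˢ D).filter
    (fun x => H = (x.1 + x.2.1) * (x.2.2.1 + x.2.2.2))).card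

/-
Detecting `X = a + b` and `X⁻¹ H = c + d` by additive characters turns the number of solutions
into a sum over `(U, V)` of the Fourier transforms of the four sets against the matrix Kloosterman
sum `K(-U, -HV)`, where `K(U, V) = ∑ ψ (tr (U X) + tr (V X⁻¹))` over invertible `X`. The pair
`(0, 0)` gives the main term, because all but a proportion `O(1/q)` of the matrices are invertible.
By Cauchy–Schwarz and Parseval the other pairs contribute an error controlled by `max |K|`.

For the Kloosterman sums with `U ≠ 0`, choose a square-zero `N` with `N U ≠ 0`, which exists as
soon as `n ≥ 2`. Translating `X` by `1 + t N` and averaging over `t` confines the sum to the `X`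
with `tr (N U X) = tr (V N X⁻¹)`, and scaling `X` makes this a nontrivial quadratic condition
except when `tr (N U X) = 0`, so only `O(q ^ (n² - 1))` matrices remain.
-/

section

open Finset Matrix

section Counting

theorem card_mul_card_filter_le_of_perm {α T : Type*} [Fintype α] [Fintype T]
    (σ : T → Equiv.Perm α) (P : α → Prop) [DecidablePred P] (k : ℕ)
    (h : ∀ x, #{t | P (σ t x)} ≤ k) :
    Fintype.card T * #{x | P x} ≤ k * Fintype.card α := by
  have card_translate (t : T) : #{x | P (σ t x)} = #{x | P x} :=
    card_equiv (σ t) (by simp)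
  calc Fintype.card T * #{x | P x}
      = ∑ t, #{x | P (σ t x)} := by simp [card_translate]
    _ = ∑ x, #{t | P (σ t x)} := by
        simp only [card_filter]
        exact sum_comm
    _ ≤ ∑ _x : α, k := sum_le_sum fun x _ => h x
    _ = k * Fintype.card α := by simp [mul_comm]

theorem card_units_sq_mul_eq_le_two {R : Type*} [CommRing R] [IsDomain R] [Fintype Rˣ]
    [DecidableEq R] {a : R} (ha : a ≠ 0) (b : R) : #{t : Rˣ | (t : R) ^ 2 * a = b} ≤ 2 := by
  rcases eq_empty_or_nonempty {t : Rˣ | (t : R) ^ 2 * a = b} with h | ⟨s, hs⟩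
  · simp [h]
  · refine (card_le_card (t := {s, -s}) fun t ht => ?_).trans card_le_two
    have hsq : (t : R) ^ 2 = (s : R) ^ 2 :=
      mul_right_cancel₀ ha ((mem_filter.1 ht).2.trans (mem_filter.1 hs).2.symm)
    simpa [Units.ext_iff] using sq_eq_sq_iff_eq_or_eq_neg.1 hsq

theorem exists_apply_ne_zero {R ι κ : Type*} [Zero R] {X : Matrix ι κ R} (hX : X ≠ 0) :
    ∃ i j, X i j ≠ 0 := by
  by_contra! h
  exact hX (Matrix.ext h)

theorem exists_trace_mul_eq {K ι : Type*} [DivisionRing K] [Fintype ι] {W : Matrix ι ι K}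
    (hW : W ≠ 0) (t : K) : ∃ X : Matrix ι ι K, (W * X).trace = t := by
  classical
  obtain ⟨i, j, hij⟩ := exists_apply_ne_zero hW
  exact ⟨single j i ((W i j)⁻¹ * t), by simp [trace_mul_single, hij]⟩

variable {F ι : Type*} [Field F] [Fintype F] [DecidableEq F] [Fintype ι] [DecidableEq ι]

theorem card_mul_card_trace_mul_eq_zero_le {W : Matrix ι ι F} (hW : W ≠ 0) :
    Fintype.card F * #{X : Matrix ι ι F | (W * X).trace = 0} ≤ Fintype.card (Matrix ι ι F) := by
  obtain ⟨E, hE⟩ := exists_trace_mul_eq hW 1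
  have := card_mul_card_filter_le_of_perm (fun t : F => Equiv.addRight (t • E))
    (fun X => (W * X).trace = 0) 1 fun X => card_le_one.2 fun s hs t ht => by
      simp only [mem_filter_univ, Equiv.coe_addRight, mul_add, trace_add,
        Matrix.mul_smul, trace_smul, hE, smul_eq_mul, mul_one] at hs ht
      linear_combination hs - ht
  simpa using this

theorem card_mul_card_det_eq_zero_le :
    Fintype.card F * #{X : Matrix ι ι F | X.det = 0}
      ≤ Fintype.card ι * Fintype.card (Matrix ι ι F) := by
  refine card_mul_card_filter_le_of_perm (fun t : F => Equiv.subLeft (scalar ι t))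
    (fun X => X.det = 0) _ fun X => ?_
  calc #{t : F | (Equiv.subLeft (scalar ι t) X).det = 0}
      ≤ #X.charpoly.roots.toFinset := card_le_card fun t ht => by
        simpa [X.charpoly_monic.ne_zero, eval_charpoly] using ht
    _ ≤ X.charpoly.roots.card := Multiset.toFinset_card_le _
    _ ≤ X.charpoly.natDegree := Polynomial.card_roots' _
    _ = Fintype.card ι := X.charpoly_natDegree_eq_dim

theorem card_det_eq_zero_add_card_GL :
    #{X : Matrix ι ι F | X.det = 0} + Fintype.card (GL ι F) = Fintype.card (Matrix ι ι F) := by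
  have compl_eq : ({X : Matrix ι ι F | X.det = 0} : Finset _)ᶜ
      = univ.map ⟨Units.val, Units.val_injective⟩ := by
    ext X
    simpa [IsUnit] using (X.isUnit_iff_isUnit_det.trans isUnit_iff_ne_zero).symm
  have card_add := card_add_card_compl ({X : Matrix ι ι F | X.det = 0} : Finset _)
  rwa [compl_eq, card_map, card_univ] at card_add

theorem card_units_mul_card_trace_mul_eq_trace_mul_inv_le (W Z : Matrix ι ι F) :
    Fintype.card Fˣ * #{X : GL ι F |
        (W * X.1).trace ≠ 0 ∧ (W * X.1).trace = (Z * X⁻¹.1).trace}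
      ≤ 2 * Fintype.card (GL ι F) := by
  refine card_mul_card_filter_le_of_perm (fun t : Fˣ => MulAction.toPerm t) _ 2 fun X => ?_
  have trace_smul_val (t : Fˣ) : (W * (t • X).1).trace = t * (W * X.1).trace := by
    simp [Units.smul_def]
  have trace_smul_inv (t : Fˣ) : (Z * (t • X)⁻¹.1).trace = (t : F)⁻¹ * (Z * X⁻¹.1).trace := by
    simp [Units.smul_def]
  by_cases hX : (W * X.1).trace = 0
  · simp [hX]
  · refine (card_le_card fun t ht => ?_).trans (card_units_sq_mul_eq_le_two hX (Z * X⁻¹.1).trace)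
    simp only [mem_filter_univ, MulAction.toPerm_apply, trace_smul_val, trace_smul_inv] at ht ⊢
    rw [sq, mul_assoc, ht.2, mul_inv_cancel_left₀ t.ne_zero]

theorem card_mul_card_trace_mul_eq_trace_mul_inv_le {W : Matrix ι ι F} (hW : W ≠ 0)
    (Z : Matrix ι ι F) :
    Fintype.card F * #{X : GL ι F | (W * X.1).trace = (Z * X⁻¹.1).trace}
      ≤ 5 * Fintype.card (Matrix ι ι F) := by
  set a := #{X : GL ι F | (W * X.1).trace ≠ 0 ∧ (W * X.1).trace = (Z * X⁻¹.1).trace}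
  set b := #{X : Matrix ι ι F | (W * X).trace = 0}
  have card_le : #{X : GL ι F | (W * X.1).trace = (Z * X⁻¹.1).trace} ≤ a + b := by
    have hb : #{X : GL ι F | (W * X.1).trace = 0} ≤ b :=
      card_le_card_of_injOn Units.val (by simp [Set.MapsTo]) Units.val_injective.injOn
    refine (card_le_card fun X hX => ?_).trans
      ((card_union_le _ _).trans (Nat.add_le_add_left hb a))
    simp only [mem_union, mem_filter_univ] at hX ⊢
    tauto
  have ha : Fintype.card Fˣ * a ≤ 2 * Fintype.card (GL ι F) :=
    card_units_mul_card_trace_mul_eq_trace_mul_inv_le W Z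
  have hb : Fintype.card F * b ≤ Fintype.card (Matrix ι ι F) :=
    card_mul_card_trace_mul_eq_zero_le hW
  have card_GL_le : Fintype.card (GL ι F) ≤ Fintype.card (Matrix ι ι F) :=
    Fintype.card_le_of_injective _ Units.val_injective
  have card_le_two_mul : Fintype.card F ≤ 2 * Fintype.card Fˣ := by
    have := Fintype.one_lt_card (α := F)
    rw [Fintype.card_units]
    lia
  calc Fintype.card F * #{X : GL ι F | (W * X.1).trace = (Z * X⁻¹.1).trace}
      ≤ Fintype.card F * (a + b) := Nat.mul_le_mul_left _ card_le
    _ ≤ 2 * (Fintype.card Fˣ * a) + Fintype.card F * b := by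
        rw [mul_add, ← mul_assoc]
        gcongr
    _ ≤ 5 * Fintype.card (Matrix ι ι F) := by lia

end Counting

section Fourier

variable {R S ι : Type*} [CommRing R] [Fintype R] [CommRing S] [Fintype ι] [DecidableEq ι]

theorem sum_addChar_trace_mul [DecidableEq R] [IsDomain S] {ψ : AddChar R S} (hψ : ψ.IsPrimitive)
    (X : Matrix ι ι R) :
    ∑ U : Matrix ι ι R, ψ (U * X).trace
      = if X = 0 then (Fintype.card (Matrix ι ι R) : S) else 0 := by
  split_ifs with hX
  · simp [hX]
  · let φ : AddChar (Matrix ι ι R) S := ψ.compAddMonoidHom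
      ((traceAddMonoidHom ι R).comp (AddMonoidHom.mulRight X))
    have hφ : φ ≠ 1 := by
      obtain ⟨i, j, hij⟩ := exists_apply_ne_zero hX
      obtain ⟨t, ht⟩ := AddChar.ne_one_iff.1 (hψ hij)
      refine AddChar.ne_one_iff.2 ⟨single j i t, ?_⟩
      simpa [φ, trace_single_mul, mul_comm t] using ht
    simpa [φ] using AddChar.sum_eq_zero_of_ne_one hφ

/-- The Fourier transform of a function on matrices with respect to the pairing
`(U, X) ↦ ψ (tr (U X))`, without normalization. -/
def matrixFourier (ψ : AddChar R S) (f : Matrix ι ι R → S) (U : Matrix ι ι R) : S :=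
  ∑ X, f X * ψ (U * X).trace

theorem matrixFourier_zero (ψ : AddChar R S) (f : Matrix ι ι R → S) :
    matrixFourier ψ f 0 = ∑ X, f X := by
  simp [matrixFourier]

theorem sum_matrixFourier_mul [IsDomain S] {ψ : AddChar R S} (hψ : ψ.IsPrimitive)
    (f : Matrix ι ι R → S) (X : Matrix ι ι R) :
    ∑ U, matrixFourier ψ f U * ψ (-(U * X).trace) = Fintype.card (Matrix ι ι R) * f X := by
  classical
  have char_mul (U Y : Matrix ι ι R) :
      f Y * ψ (U * Y).trace * ψ (-(U * X).trace) = f Y * ψ (U * (Y - X)).trace := by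
    rw [mul_assoc, ← AddChar.map_add_eq_mul, mul_sub, trace_sub, sub_eq_add_neg]
  simp only [matrixFourier, sum_mul, char_mul]
  rw [sum_comm]
  simp [← mul_sum, sum_addChar_trace_mul hψ, sub_eq_zero, mul_comm]

theorem matrixFourier_indicator (ψ : AddChar R S) (A : Finset (Matrix ι ι R))
    (U : Matrix ι ι R) :
    matrixFourier ψ ((A : Set (Matrix ι ι R)).indicator 1) U = ∑ a ∈ A, ψ (U * a).trace := by
  classical simp [matrixFourier, Set.indicator_apply]

theorem matrixFourier_addConvolution [DecidableEq R] (ψ : AddChar R S)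
    (A B : Finset (Matrix ι ι R)) (U : Matrix ι ι R) :
    matrixFourier ψ (fun X => (A.addConvolution B X : S)) U
      = matrixFourier ψ ((A : Set (Matrix ι ι R)).indicator 1) U
        * matrixFourier ψ ((B : Set (Matrix ι ι R)).indicator 1) U := by
  calc matrixFourier ψ (fun X => (A.addConvolution B X : S)) U
      = ∑ X, ∑ x ∈ A ×ˢ B with x.1 + x.2 = X, ψ (U * (x.1 + x.2)).trace := by
        refine sum_congr rfl fun X _ => ?_
        rw [sum_congr rfl fun x hx => by rw [(mem_filter.1 hx).2], sum_const, nsmul_eq_mul]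
        rfl
    _ = ∑ x ∈ A ×ˢ B, ψ (U * (x.1 + x.2)).trace := sum_fiberwise _ _ _
    _ = (∑ a ∈ A, ψ (U * a).trace) * ∑ b ∈ B, ψ (U * b).trace := by
        simp only [sum_mul_sum, sum_product, mul_add, trace_add, AddChar.map_add_eq_mul]
    _ = _ := by simp only [matrixFourier_indicator]

theorem sum_addConvolution [DecidableEq R] (A B : Finset (Matrix ι ι R)) :
    ∑ X, A.addConvolution B X = #A * #B := by
  rw [← card_product]
  exact (card_eq_sum_card_fiberwise fun _ _ => mem_univ _).symm

theorem sum_norm_sq_matrixFourier {ψ : AddChar R ℂ} (hψ : ψ.IsPrimitive)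
    (f : Matrix ι ι R → ℂ) :
    ∑ U, ‖matrixFourier ψ f U‖ ^ 2 = Fintype.card (Matrix ι ι R) * ∑ X, ‖f X‖ ^ 2 := by
  have conj_matrixFourier (U : Matrix ι ι R) : (starRingEnd ℂ) (matrixFourier ψ f U)
      = ∑ X, (starRingEnd ℂ) (f X) * ψ (-(U * X).trace) := by
    simp [matrixFourier, AddChar.map_neg_eq_conj]
  have : ∑ U, matrixFourier ψ f U * (starRingEnd ℂ) (matrixFourier ψ f U)
      = Fintype.card (Matrix ι ι R) * ∑ X, f X * (starRingEnd ℂ) (f X) := by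
    calc _ = ∑ X, (starRingEnd ℂ) (f X) * ∑ U, matrixFourier ψ f U * ψ (-(U * X).trace) := by
          simp only [conj_matrixFourier, mul_sum, mul_left_comm]
          exact sum_comm
      _ = _ := by
          rw [mul_sum]
          exact sum_congr rfl fun X _ => by rw [sum_matrixFourier_mul hψ]; ring
  simp only [Complex.mul_conj'] at this
  exact_mod_cast this

theorem sum_norm_matrixFourier_mul_le {ψ : AddChar R ℂ} (hψ : ψ.IsPrimitive)
    (f g : Matrix ι ι R → ℂ) :
    ∑ U, ‖matrixFourier ψ f U‖ * ‖matrixFourier ψ g U‖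
      ≤ Fintype.card (Matrix ι ι R) * √((∑ X, ‖f X‖ ^ 2) * ∑ X, ‖g X‖ ^ 2) := by
  refine (Real.sum_mul_le_sqrt_mul_sqrt univ _ _).trans_eq ?_
  rw [sum_norm_sq_matrixFourier hψ, sum_norm_sq_matrixFourier hψ, ← Real.sqrt_mul (by positivity),
    mul_mul_mul_comm, Real.sqrt_mul (by positivity), Real.sqrt_mul_self (by positivity)]

theorem sum_norm_matrixFourier_addConvolution_le [DecidableEq R] {ψ : AddChar R ℂ}
    (hψ : ψ.IsPrimitive) (A B : Finset (Matrix ι ι R)) :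
    ∑ U, ‖matrixFourier ψ (fun X => (A.addConvolution B X : ℂ)) U‖
      ≤ Fintype.card (Matrix ι ι R) * √(#A * #B) := by
  have sum_norm_sq_indicator (A : Finset (Matrix ι ι R)) :
      ∑ X, ‖(A : Set (Matrix ι ι R)).indicator (1 : Matrix ι ι R → ℂ) X‖ ^ 2 = #A := by
    classical simp [Set.indicator_apply, apply_ite]
  simpa only [matrixFourier_addConvolution, norm_mul, sum_norm_sq_indicator] using
    sum_norm_matrixFourier_mul_le hψ ((A : Set (Matrix ι ι R)).indicator 1)
      ((B : Set (Matrix ι ι R)).indicator 1)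

end Fourier

section Kloosterman

section CommRing

variable {R S ι : Type*} [CommRing R] [Fintype R] [DecidableEq R] [CommRing S] [Fintype ι]
  [DecidableEq ι]

/-- The matrix Kloosterman sum `K(U, V)`, summed over the invertible matrices only. It is the weight
of a pair of Fourier coefficients in the count of factorizations `H = X * (X⁻¹ * H)`. -/
def matrixKloosterman (ψ : AddChar R S) (U V : Matrix ι ι R) : S :=
  ∑ X : GL ι R, ψ ((U * X.1).trace + (V * X⁻¹.1).trace)

theorem matrixKloosterman_zero_zero (ψ : AddChar R S) :
    matrixKloosterman ψ (0 : Matrix ι ι R) 0 = Fintype.card (GL ι R) := by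
  simp [matrixKloosterman]

theorem matrixKloosterman_comm (ψ : AddChar R S) (U V : Matrix ι ι R) :
    matrixKloosterman ψ U V = matrixKloosterman ψ V U :=
  Fintype.sum_equiv (Equiv.inv (GL ι R)) _ _ fun X => by simp [add_comm]

theorem matrixKloosterman_mul_left_mul_inv_right (ψ : AddChar R S) (U V : Matrix ι ι R)
    (Y : GL ι R) : matrixKloosterman ψ (Y.1 * U) (V * Y⁻¹.1) = matrixKloosterman ψ U V := by
  refine Fintype.sum_equiv (Equiv.mulRight Y) _ _ fun X => ?_
  simp only [Equiv.coe_mulRight]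
  rw [_root_.mul_inv_rev, Units.val_mul, Units.val_mul, ← Matrix.mul_assoc U,
    trace_mul_comm _ Y.1, Matrix.mul_assoc, Matrix.mul_assoc]

theorem sum_matrixKloosterman_add_smul_sub_smul [IsDomain S] {ψ : AddChar R S}
    (hψ : ψ.IsPrimitive) (U V W Z : Matrix ι ι R) :
    ∑ t : R, matrixKloosterman ψ (U + t • W) (V - t • Z)
      = Fintype.card R * ∑ X : GL ι R with (W * X.1).trace = (Z * X⁻¹.1).trace,
          ψ ((U * X.1).trace + (V * X⁻¹.1).trace) := by
  have char_eq (t : R) (X : GL ι R) :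
      ψ (((U + t • W) * X.1).trace + ((V - t • Z) * X⁻¹.1).trace)
        = ψ ((U * X.1).trace + (V * X⁻¹.1).trace)
          * ψ (t * ((W * X.1).trace - (Z * X⁻¹.1).trace)) := by
    rw [← AddChar.map_add_eq_mul]
    simp only [add_mul, sub_mul, smul_mul, trace_add, trace_sub, trace_smul, smul_eq_mul]
    ring_nf
  simp only [matrixKloosterman, char_eq]
  rw [sum_comm, sum_filter, mul_sum]
  refine sum_congr rfl fun X _ => ?_
  rw [← mul_sum, AddChar.sum_mulShift _ hψ]
  simp only [sub_eq_zero]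
  split_ifs <;> simp [mul_comm]

theorem sum_mul_inv_mul_eq_sum_matrixFourier_mul_matrixKloosterman [IsDomain S]
    {ψ : AddChar R S} (hψ : ψ.IsPrimitive) (f g : Matrix ι ι R → S) (H : Matrix ι ι R) :
    (Fintype.card (Matrix ι ι R) : S) ^ 2 * ∑ X : GL ι R, f X.1 * g (X⁻¹.1 * H)
      = ∑ U, ∑ V, matrixFourier ψ f U * matrixFourier ψ g V
          * matrixKloosterman ψ (-U) (-(H * V)) := by
  have trace_eq (X : GL ι R) (V : Matrix ι ι R) :
      (V * (X⁻¹.1 * H)).trace = (H * V * X⁻¹.1).trace := by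
    rw [← Matrix.mul_assoc, trace_mul_comm, Matrix.mul_assoc]
  calc _ = ∑ X : GL ι R, (∑ U, matrixFourier ψ f U * ψ (-(U * X.1).trace))
          * ∑ V, matrixFourier ψ g V * ψ (-(V * (X⁻¹.1 * H)).trace) := by
        rw [mul_sum]
        refine sum_congr rfl fun X _ => ?_
        rw [sum_matrixFourier_mul hψ, sum_matrixFourier_mul hψ]
        ring
    _ = ∑ X : GL ι R, ∑ U, ∑ V, matrixFourier ψ f U * matrixFourier ψ g V
          * ψ ((-U * X.1).trace + (-(H * V) * X⁻¹.1).trace) := by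
        simp only [sum_mul_sum, trace_eq, mul_mul_mul_comm, ← AddChar.map_add_eq_mul,
          Matrix.neg_mul, trace_neg]
    _ = _ := by
        rw [sum_comm]
        refine sum_congr rfl fun U _ => ?_
        rw [sum_comm]
        simp only [matrixKloosterman, mul_sum]

end CommRing

theorem exists_mul_self_eq_zero_mul_ne_zero {R ι : Type*} [Semiring R] [Fintype ι]
    [Nontrivial ι] {U : Matrix ι ι R} (hU : U ≠ 0) :
    ∃ N : Matrix ι ι R, N * N = 0 ∧ N * U ≠ 0 := by
  classical
  obtain ⟨i, j, hij⟩ := exists_apply_ne_zero hU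
  obtain ⟨k, hk⟩ := exists_ne i
  refine ⟨single k i 1, single_mul_single_of_ne _ _ _ _ hk.symm _, fun h => hij ?_⟩
  simpa using congrFun (congrFun h k) j

/-- The unit `1 + x` attached to a square-zero element `x` of a ring. Over a field, the units
`1 + t N` with `N * N = 0` are those by which Kloosterman sums are averaged. -/
def unitOneAdd {R : Type*} [Ring R] {x : R} (hx : x * x = 0) : Rˣ where
  val := 1 + x
  inv := 1 - x
  val_inv := by simp [add_mul, mul_sub, hx]
  inv_val := by simp [sub_mul, mul_add, hx]

variable {F ι : Type*} [Field F] [Fintype F] [DecidableEq F] [Fintype ι] [DecidableEq ι]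
  [Nontrivial ι] {ψ : AddChar F ℂ}

theorem card_mul_norm_matrixKloosterman_le_of_ne_zero_left (hψ : ψ.IsPrimitive)
    {U : Matrix ι ι F} (hU : U ≠ 0) (V : Matrix ι ι F) :
    Fintype.card F * ‖matrixKloosterman ψ U V‖ ≤ 5 * Fintype.card (Matrix ι ι F) := by
  obtain ⟨N, hN, hNU⟩ := exists_mul_self_eq_zero_mul_ne_zero hU
  have translate (t : F) :
      matrixKloosterman ψ (U + t • (N * U)) (V - t • (V * N)) = matrixKloosterman ψ U V := by
    have hN : (t • N) * (t • N) = 0 := by simp [hN]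
    simpa [unitOneAdd, add_mul, mul_sub] using
      matrixKloosterman_mul_left_mul_inv_right ψ U V (unitOneAdd hN)
  have average : matrixKloosterman ψ U V
      = ∑ X : GL ι F with (N * U * X.1).trace = (V * N * X⁻¹.1).trace,
          ψ ((U * X.1).trace + (V * X⁻¹.1).trace) := by
    have := sum_matrixKloosterman_add_smul_sub_smul hψ U V (N * U) (V * N)
    simpa [translate, Fintype.card_ne_zero] using this
  calc Fintype.card F * ‖matrixKloosterman ψ U V‖
      ≤ Fintype.card F * #{X : GL ι F | (N * U * X.1).trace = (V * N * X⁻¹.1).trace} := by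
        rw [average]
        gcongr
        exact (norm_sum_le _ _).trans_eq (by simp [AddChar.norm_apply])
    _ ≤ 5 * Fintype.card (Matrix ι ι F) := by
        exact_mod_cast card_mul_card_trace_mul_eq_trace_mul_inv_le hNU (V * N)

theorem card_mul_norm_matrixKloosterman_le (hψ : ψ.IsPrimitive) {U V : Matrix ι ι F}
    (h : ¬(U = 0 ∧ V = 0)) :
    Fintype.card F * ‖matrixKloosterman ψ U V‖ ≤ 5 * Fintype.card (Matrix ι ι F) := by
  rcases not_and_or.1 h with hU | hV
  · exact card_mul_norm_matrixKloosterman_le_of_ne_zero_left hψ hU V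
  · rw [matrixKloosterman_comm]
    exact card_mul_norm_matrixKloosterman_le_of_ne_zero_left hψ hV U

theorem card_mul_norm_matrixKloosterman_sub_le (hψ : ψ.IsPrimitive) (U V : Matrix ι ι F) :
    Fintype.card F * ‖matrixKloosterman ψ U V
        - if U = 0 ∧ V = 0 then (Fintype.card (Matrix ι ι F) : ℂ) else 0‖
      ≤ (Fintype.card ι + 5) * Fintype.card (Matrix ι ι F) := by
  split_ifs with h
  · obtain ⟨rfl, rfl⟩ := h
    have hdet : (Fintype.card F : ℝ) * #{X : Matrix ι ι F | X.det = 0}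
        ≤ Fintype.card ι * Fintype.card (Matrix ι ι F) := by
      exact_mod_cast card_mul_card_det_eq_zero_le
    calc _ = (Fintype.card F : ℝ) * #{X : Matrix ι ι F | X.det = 0} := by
          rw [matrixKloosterman_zero_zero, ← card_det_eq_zero_add_card_GL, Nat.cast_add,
            sub_add_cancel_right, norm_neg, Complex.norm_natCast]
      _ ≤ _ := hdet.trans (by gcongr; simp)
  · rw [sub_zero]
    exact (card_mul_norm_matrixKloosterman_le hψ h).trans (by gcongr; simp)

theorem card_mul_norm_sum_mul_inv_mul_sub_le (hψ : ψ.IsPrimitive) (f g : Matrix ι ι F → ℂ)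
    (H : GL ι F) :
    Fintype.card F * ‖(Fintype.card (Matrix ι ι F) : ℂ) ^ 2
          * ∑ X : GL ι F, f X.1 * g (X⁻¹.1 * H.1)
        - Fintype.card (Matrix ι ι F) * ((∑ X, f X) * ∑ X, g X)‖
      ≤ (Fintype.card ι + 5) * Fintype.card (Matrix ι ι F)
        * ((∑ U, ‖matrixFourier ψ f U‖) * ∑ V, ‖matrixFourier ψ g V‖) := by
  let main (U V : Matrix ι ι F) : ℂ :=
    if U = 0 ∧ V = 0 then (Fintype.card (Matrix ι ι F) : ℂ) else 0
  let error (U V : Matrix ι ι F) : ℂ := matrixKloosterman ψ (-U) (-(H.1 * V)) - main U V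
  have error_le (U V : Matrix ι ι F) : Fintype.card F * ‖error U V‖
      ≤ (Fintype.card ι + 5) * Fintype.card (Matrix ι ι F) := by
    simpa [error, main] using card_mul_norm_matrixKloosterman_sub_le hψ (-U) (-(H.1 * V))
  have sum_main : ∑ U, ∑ V, matrixFourier ψ f U * matrixFourier ψ g V * main U V
      = Fintype.card (Matrix ι ι F) * ((∑ X, f X) * ∑ X, g X) := by
    simp [main, ite_and, matrixFourier_zero, mul_comm]
  rw [sum_mul_inv_mul_eq_sum_matrixFourier_mul_matrixKloosterman hψ, ← sum_main]
  simp only [← sum_sub_distrib, ← mul_sub]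
  calc Fintype.card F * ‖∑ U, ∑ V, matrixFourier ψ f U * matrixFourier ψ g V * error U V‖
      ≤ Fintype.card F * ∑ U, ∑ V, ‖matrixFourier ψ f U * matrixFourier ψ g V * error U V‖ := by
        gcongr
        exact (norm_sum_le _ _).trans (sum_le_sum fun U _ => norm_sum_le _ _)
    _ = ∑ U, ∑ V, Fintype.card F * ‖error U V‖
          * (‖matrixFourier ψ f U‖ * ‖matrixFourier ψ g V‖) := by
        simp only [mul_sum, norm_mul, mul_assoc, mul_left_comm, mul_comm]
    _ ≤ ∑ U, ∑ V, (Fintype.card ι + 5) * Fintype.card (Matrix ι ι F)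
          * (‖matrixFourier ψ f U‖ * ‖matrixFourier ψ g V‖) := by
        exact sum_le_sum fun U _ => sum_le_sum fun V _ =>
          mul_le_mul_of_nonneg_right (error_le U V) (by positivity)
    _ = _ := by
        rw [sum_mul_sum]
        simp only [mul_sum]

theorem card_mul_abs_sum_addConvolution_mul_sub_le (A B C D : Finset (Matrix ι ι F))
    (H : GL ι F) :
    (Fintype.card F : ℝ) * |∑ X : GL ι F,
          (A.addConvolution B X.1 : ℝ) * C.addConvolution D (X⁻¹.1 * H.1)
        - #A * #B * #C * #D / Fintype.card (Matrix ι ι F)|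
      ≤ (Fintype.card ι + 5) * Fintype.card (Matrix ι ι F) * √(#A * #B * #C * #D) := by
  have hψ := AddChar.FiniteField.primitiveChar_to_Complex_isPrimitive F
  have bound := (card_mul_norm_sum_mul_inv_mul_sub_le hψ (fun X => (A.addConvolution B X : ℂ))
    (fun X => (C.addConvolution D X : ℂ)) H).trans (mul_le_mul_of_nonneg_left
      (mul_le_mul (sum_norm_matrixFourier_addConvolution_le hψ A B)
        (sum_norm_matrixFourier_addConvolution_le hψ C D) (by positivity) (by positivity))
      (by positivity))
  set q := Fintype.card F
  set Q := Fintype.card (Matrix ι ι F)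
  set T : ℝ := ∑ X : GL ι F, (A.addConvolution B X.1 : ℝ) * C.addConvolution D (X⁻¹.1 * H.1)
    with hT
  have hQ : (0 : ℝ) < Q := Nat.cast_pos.2 Fintype.card_pos
  have hQ' : (Q : ℂ) ≠ 0 := by exact_mod_cast hQ.ne'
  have norm_eq : ‖(Q : ℂ) ^ 2 * ∑ X : GL ι F,
        (A.addConvolution B X.1 : ℂ) * C.addConvolution D (X⁻¹.1 * H.1)
      - Q * ((∑ X, (A.addConvolution B X : ℂ)) * ∑ X, (C.addConvolution D X : ℂ))‖
      = Q ^ 2 * |T - #A * #B * #C * #D / Q| := by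
    simp only [← Nat.cast_sum, sum_addConvolution]
    rw [← abs_of_pos (pow_pos hQ 2), ← abs_mul, ← Real.norm_eq_abs, ← Complex.norm_real, hT]
    push_cast
    congr 1
    field_simp
  have sqrt_eq : √(#A * #B * #C * #D : ℝ) = √(#A * #B) * √(#C * #D) := by
    rw [← Real.sqrt_mul (by positivity), mul_assoc (#A * #B : ℝ)]
  rw [norm_eq] at bound
  rw [sqrt_eq]
  refine le_of_mul_le_mul_left ?_ (pow_pos hQ 2)
  linarith

end Kloosterman

section SumProdCount

variable {n : ℕ} {F : Type*} [Field F] [DecidableEq F] (A B C D : Finset (Matrix (Fin n) (Fin n) F))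

theorem sumProdCount_eq_sum_addConvolution_mul [Fintype F] (H : GL (Fin n) F) :
    sumProdCount A B C D H.1
      = ∑ X : GL (Fin n) F, A.addConvolution B X.1 * C.addConvolution D (X⁻¹.1 * H.1) := by
  have factorization (P Q : Matrix (Fin n) (Fin n) F) :
      (if H.1 = P * Q then 1 else 0)
        = ∑ X : GL (Fin n) F, if P = X.1 ∧ Q = X⁻¹.1 * H.1 then 1 else 0 := by
    by_cases hP : IsUnit P
    · obtain ⟨Y, rfl⟩ := hP
      have eq_mul_iff : H.1 = Y.1 * Q ↔ Q = Y⁻¹.1 * H.1 := by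
        rw [Units.eq_inv_mul_iff_mul_eq, eq_comm]
      simp [-coe_units_inv, ite_and, Units.val_inj, eq_mul_iff]
    · rw [if_neg fun h => hP (isUnit_of_mul_isUnit_left (h ▸ H.isUnit))]
      refine (sum_eq_zero fun X _ => if_neg ?_).symm
      rintro ⟨rfl, -⟩
      exact hP X.isUnit
  simp only [sumProdCount, card_filter, factorization]
  rw [sum_comm]
  refine sum_congr rfl fun X _ => ?_
  simp only [addConvolution, card_filter, sum_product, sum_mul]
  simp only [mul_sum, ite_and, ite_mul, one_mul, zero_mul]

theorem abs_sumProdCount_sub_le [Fintype F] (hn : 2 ≤ n) (H : GL (Fin n) F) :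
    |(sumProdCount A B C D H.1 : ℝ) - #A * #B * #C * #D / (Fintype.card F : ℝ) ^ (n ^ 2)|
      ≤ (n + 5) * ((Fintype.card F : ℝ) ^ ((n : ℝ) ^ 2 - 1) * √(#A * #B * #C * #D)) := by
  have : Nontrivial (Fin n) := Fin.nontrivial_iff_two_le.2 hn
  have hq : (0 : ℝ) < Fintype.card F := Nat.cast_pos.2 Fintype.card_pos
  have card_matrix : (Fintype.card (Matrix (Fin n) (Fin n) F) : ℝ)
      = (Fintype.card F : ℝ) ^ (n ^ 2) := by
    rw [← Nat.card_eq_fintype_card]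
    simp [Matrix, ← pow_mul, sq]
  have pow_eq : (Fintype.card F : ℝ) ^ (n ^ 2)
      = Fintype.card F * (Fintype.card F : ℝ) ^ ((n : ℝ) ^ 2 - 1) := by
    rw [Real.rpow_sub_one hq.ne', mul_div_cancel₀ _ hq.ne', ← Nat.cast_pow n, Real.rpow_natCast]
  have bound := card_mul_abs_sum_addConvolution_mul_sub_le A B C D H
  refine le_of_mul_le_mul_left ?_ hq
  rw [sumProdCount_eq_sum_addConvolution_mul, Nat.cast_sum]
  simp only [Nat.cast_mul]
  rw [card_matrix, Fintype.card_fin] at bound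
  refine bound.trans_eq ?_
  nth_rw 1 [pow_eq]
  ring

variable {A B C D}

theorem exists_of_sumProdCount_pos {H : Matrix (Fin n) (Fin n) F}
    (h : 0 < sumProdCount A B C D H) :
    ∃ a ∈ A, ∃ b ∈ B, ∃ c ∈ C, ∃ d ∈ D, H = (a + b) * (c + d) := by
  obtain ⟨⟨a, b, c, d⟩, hx⟩ := card_pos.1 h
  simp only [mem_filter, mem_product] at hx
  exact ⟨a, hx.1.1, b, hx.1.2.1, c, hx.1.2.2.1, d, hx.1.2.2.2, hx.2⟩

theorem sumProdCount_pos_of_lt_card [Fintype F] (hn : 2 ≤ n)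
    (hcard : (n + 5) ^ 2 * (Fintype.card F : ℝ) ^ (4 * (n : ℝ) ^ 2 - 2) < #A * #B * #C * #D)
    (H : GL (Fin n) F) : 0 < sumProdCount A B C D H.1 := by
  by_contra! hzero
  have bound := abs_sumProdCount_sub_le A B C D hn H
  set q := (Fintype.card F : ℝ)
  set s := (#A * #B * #C * #D : ℝ)
  have hq : 0 < q := Nat.cast_pos.2 Fintype.card_pos
  have hs : 0 < s := lt_of_le_of_lt (by positivity) hcard
  rw [Nat.le_zero.1 hzero, Nat.cast_zero, zero_sub, abs_neg, abs_of_pos (by positivity),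
    div_le_iff₀ (by positivity)] at bound
  have pow_mul_pow : (q ^ ((n : ℝ) ^ 2 - 1) * q ^ (n ^ 2)) ^ 2 = q ^ (4 * (n : ℝ) ^ 2 - 2) := by
    rw [← Real.rpow_natCast q, ← Real.rpow_add hq, ← Real.rpow_mul_natCast hq.le]
    push_cast
    ring_nf
  have sqrt_le : √s ≤ (n + 5) * (q ^ ((n : ℝ) ^ 2 - 1) * q ^ (n ^ 2)) := by
    refine le_of_mul_le_mul_right ?_ (Real.sqrt_pos.2 hs)
    rw [Real.mul_self_sqrt hs.le]
    linarith
  have le_sq := (Real.sqrt_le_left (by positivity)).1 sqrt_le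
  rw [mul_pow, pow_mul_pow] at le_sq
  exact hcard.not_ge le_sq

end SumProdCount

end

theorem theorem8_general (n : ℕ) (hn : 2 ≤ n) {F : Type*} [Field F] [Fintype F] [DecidableEq F]
    (A B C D : Finset (Matrix (Fin n) (Fin n) F)) (H : Matrix.GeneralLinearGroup (Fin n) F) :
    |(sumProdCount A B C D (H : Matrix (Fin n) (Fin n) F) : ℝ)
          - ((A.card : ℝ) * (B.card : ℝ) * (C.card : ℝ) * (D.card : ℝ))
              / (Fintype.card F : ℝ) ^ (n ^ 2)|
        ≤ (n + 5) * ((Fintype.card F : ℝ) ^ ((n : ℝ) ^ 2 - 1)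
            * Real.sqrt ((A.card : ℝ) * (B.card : ℝ) * (C.card : ℝ) * (D.card : ℝ))) ∧
      ((n + 5) ^ 2 * (Fintype.card F : ℝ) ^ (4 * (n : ℝ) ^ 2 - 2)
          < (A.card : ℝ) * (B.card : ℝ) * (C.card : ℝ) * (D.card : ℝ) →
        ∃ a ∈ A, ∃ b ∈ B, ∃ c ∈ C, ∃ d ∈ D,
          (H : Matrix (Fin n) (Fin n) F) = (a + b) * (c + d)) :=
  ⟨abs_sumProdCount_sub_le A B C D hn H,
    fun hcard => exists_of_sumProdCount_pos (sumProdCount_pos_of_lt_card hn hcard H)⟩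

theorem theorem8 (n : ℕ) (hn : 2 ≤ n) :
    (∃ K : ℝ, 0 < K ∧
      ∀ (F : Type*) [Field F] [Fintype F] [DecidableEq F]
        (A B C D : Finset (Matrix (Fin n) (Fin n) F))
        (H : Matrix.GeneralLinearGroup (Fin n) F),
        |(sumProdCount A B C D (H : Matrix (Fin n) (Fin n) F) : ℝ)
            - ((A.card : ℝ) * (B.card : ℝ) * (C.card : ℝ) * (D.card : ℝ))
                / (Fintype.card F : ℝ) ^ (n ^ 2)|
          ≤ K * ((Fintype.card F : ℝ) ^ ((n : ℝ) ^ 2 - 1 / 2)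
              * Real.sqrt ((A.card : ℝ) * (B.card : ℝ) * (C.card : ℝ) * (D.card : ℝ)))) ∧
    (∃ c : ℝ, 0 < c ∧
      ∀ (F : Type*) [Field F] [Fintype F] [DecidableEq F]
        (A B C D : Finset (Matrix (Fin n) (Fin n) F)),
        c * (Fintype.card F : ℝ) ^ (4 * (n : ℝ) ^ 2 - 1)
            ≤ (A.card : ℝ) * (B.card : ℝ) * (C.card : ℝ) * (D.card : ℝ) →
        ∀ H : Matrix.GeneralLinearGroup (Fin n) F,
          ∃ a ∈ A, ∃ b ∈ B, ∃ c' ∈ C, ∃ d ∈ D,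
            (H : Matrix (Fin n) (Fin n) F) = (a + b) * (c' + d)) := by
  refine ⟨⟨n + 5, by positivity, fun F _ _ _ A B C D H => ?_⟩,
    ⟨(n + 5) ^ 2, by positivity, fun F _ _ _ A B C D hcard H => ?_⟩⟩ <;>
    have hq : (1 : ℝ) < Fintype.card F := Nat.one_lt_cast.2 Fintype.one_lt_card
  · refine (theorem8_general n hn A B C D H).1.trans ?_
    gcongr
    · exact hq.le
    · norm_num
  · refine (theorem8_general n hn A B C D H).2 (lt_of_lt_of_le ?_ hcard)
    have := Real.rpow_lt_rpow_of_exponent_lt hq (sub_lt_sub_left one_lt_two (4 * (n : ℝ) ^ 2))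
    gcongr
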